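/- Let $I\subseteq\mathbb R$ be an interval and let $\rho\ge 0$ be a probability density on $I$, continuous in the interior of $I$, with moments of every order, such that the polynomials are dense in the real Hilbert space $L^2(I,\rho)$. Write $c_1=\int_I t\rho(t)\,dt$, $\langle f,g\rangle_\rho=\int_I f(t)g(t)\rho(t)\,dt$ and $S_\rho(z)=\int_I\frac{\rho(t)\,dt}{z-t}$. Suppose that $\rho$ has a secondary measure with density $\mu$, i.e. $\mu\ge 0$ is a density on $I$ with moments of every order and $$S_\mu(z)=z-c_1-\frac1{S_\rho(z)}\qquad(z\in\mathbb C\setminus\overline I).$$ Let $T_\rho:L^2(I,\rho)\to L^2(I,\mu)$ be the continuous linear extension of the operator creating secondary polynomials, $$p\longmapsto\int_I\frac{p(t)-p(x)}{t-x}\,\rho(t)\,dt\qquad(p\text{ a polynomial}).$$ Suppose that the reducer $\varphi(x)=\lim_{\varepsilon\to0^+}2\int_I\frac{(x-t)\rho(t)\,dt}{(x-t)^2+\varepsilon^2}$ exists for almost every $x\in I$, and that $\rho$ is reducible: $\varphi\in L^2(I,\rho)$, this limit also holds in the norm of $L^2(I,\rho)$, and $\rho/\mu$ belongs to the image of $T_\rho$.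 Then $T_\rho$ is well defined (the extension exists), and for every $f\in L^2(I,\rho)$ the functions $f\varphi\rho$ and $T_\rho(f)\rho$ are integrable on $I$ and $$\langle f,\varphi\rangle_\rho=\langle T_\rho(f),1\rangle_\rho,\qquad\text{i.e.}\qquad \int_I f\varphi\,\rho\,dx=\int_I T_\rho(f)\,\rho\,dx .$$ -/

import Mathlib

open MeasureTheory Filter Topology Polynomial
open scoped ENNReal

noncomputable section

namespace SecondaryMeasure

/-- The measure on the real line carried by `I`, with density `w` there. -/
def densityMeasure (I : Set ℝ) (w : ℝ → ℝ) : Measure ℝ :=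
  (volume.restrict I).withDensity (fun t => ENNReal.ofReal (w t))

/-- The real Hilbert space `L²(I, w)`. -/
abbrev L2 (I : Set ℝ) (w : ℝ → ℝ) : Type :=
  Lp ℝ 2 (densityMeasure I w)

/-- The density `w` on `I` admits moments of any order. -/
def HasMoments (I : Set ℝ) (w : ℝ → ℝ) : Prop :=
  ∀ n : ℕ, IntegrableOn (fun t => t ^ n * w t) I

/-- The Stieltjes transform `z ↦ ∫_I w(t) dt / (z - t)`. -/
def stieltjes (I : Set ℝ) (w : ℝ → ℝ) (z : ℂ) : ℂ :=
  ∫ t in I, (w t : ℂ) / (z - (t : ℂ))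

/-- The value at `x` of the secondary polynomial of `p`, i.e.
`∫_I (p(t) - p(x)) / (t - x) w(t) dt`. -/
def secondaryFun (I : Set ℝ) (w : ℝ → ℝ) (p : ℝ[X]) (x : ℝ) : ℝ :=
  ∫ t in I, (p.eval t - p.eval x) / (t - x) * w t

/-! Facts needed to regard polynomials and secondary polynomials as elements of `L²`. -/

theorem HasMoments.integrableOn_eval_mul {I : Set ℝ} {w : ℝ → ℝ} (h : HasMoments I w) (p : ℝ[X]) :
    IntegrableOn (fun t => p.eval t * w t) I := by
  induction p using Polynomial.induction_on' with
  | add p q hp hq =>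
    have := hp.add hq
    refine this.congr (Eventually.of_forall fun t => ?_)
    simp [add_mul]
  | monomial n a =>
    have := (h n).const_mul a
    refine this.congr (Eventually.of_forall fun t => ?_)
    simp [mul_assoc]

theorem HasMoments.aemeasurable {I : Set ℝ} {w : ℝ → ℝ} (h : HasMoments I w) :
    AEMeasurable w (volume.restrict I) := by
  have := (h 0).aestronglyMeasurable.aemeasurable
  simpa using this

theorem HasMoments.memLp_eval {I : Set ℝ} {w : ℝ → ℝ} (h : HasMoments I w) (p : ℝ[X]) :
    MemLp (fun t => p.eval t) 2 (densityMeasure I w) := by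
  have hc : Continuous fun t : ℝ => p.eval t := p.continuous
  rw [memLp_two_iff_integrable_sq hc.aestronglyMeasurable, densityMeasure,
    integrable_withDensity_iff_integrable_smul₀' h.aemeasurable.ennreal_ofReal
      (Eventually.of_forall fun t => ENNReal.ofReal_lt_top)]
  have hi := h.integrableOn_eval_mul (p ^ 2)
  refine Integrable.mono hi ?_ (Eventually.of_forall fun t => ?_)
  · exact (h.aemeasurable.ennreal_ofReal.ennreal_toReal.mul
      (hc.pow 2).aemeasurable).aestronglyMeasurable
  · simp only [smul_eq_mul, norm_mul, eval_pow, Real.norm_eq_abs, ENNReal.toReal_ofReal']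
    rw [mul_comm]
    refine mul_le_mul_of_nonneg_left ?_ (abs_nonneg _)
    rw [abs_of_nonneg (le_max_right _ _)]
    exact max_le (le_abs_self _) (abs_nonneg _)

/-- The integrand of `secondaryFun` agrees with a polynomial in `t` off `t = x`. -/
theorem dslope_eq (p : ℝ[X]) {t x : ℝ} (htx : t ≠ x) :
    (p.eval t - p.eval x) / (t - x) = (p /ₘ (X - C x)).eval t := by
  have h1 : (X - C x) * (p /ₘ (X - C x)) = p - C (p.eval x) := by
    have h2 := modByMonic_add_div p (X - C x)
    rw [modByMonic_X_sub_C_eq_C_eval] at h2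
    exact eq_sub_of_add_eq' h2
  have h3 := congrArg (Polynomial.eval t) h1
  simp only [eval_mul, eval_sub, eval_X, eval_C] at h3
  rw [← h3, mul_div_cancel_left₀ _ (sub_ne_zero.mpr htx)]

theorem ae_ne (I : Set ℝ) (x : ℝ) : ∀ᵐ t ∂(volume.restrict I), t ≠ x :=
  ae_restrict_of_ae (by simp [ae_iff])

theorem HasMoments.integrableOn_quotient {I : Set ℝ} {w : ℝ → ℝ} (h : HasMoments I w) (p : ℝ[X])
    (x : ℝ) : IntegrableOn (fun t => (p.eval t - p.eval x) / (t - x) * w t) I := by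
  refine (h.integrableOn_eval_mul (p /ₘ (X - C x))).congr ?_
  filter_upwards [ae_ne I x] with t ht
  rw [dslope_eq p ht]

theorem HasMoments.secondaryFun_add {I : Set ℝ} {w : ℝ → ℝ} (h : HasMoments I w) (p q : ℝ[X])
    (x : ℝ) : secondaryFun I w (p + q) x = secondaryFun I w p x + secondaryFun I w q x := by
  unfold secondaryFun
  rw [← integral_add (h.integrableOn_quotient p x) (h.integrableOn_quotient q x)]
  refine integral_congr_ae (Eventually.of_forall fun t => ?_)
  simp only [eval_add]
  ring

theorem secondaryFun_smul (I : Set ℝ) (w : ℝ → ℝ) (a : ℝ) (p : ℝ[X])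
    (x : ℝ) : secondaryFun I w (a • p) x = a * secondaryFun I w p x := by
  unfold secondaryFun
  rw [← integral_const_mul]
  refine integral_congr_ae (Eventually.of_forall fun t => ?_)
  simp only [eval_smul, smul_eq_mul]
  ring

/-- The secondary function of a polynomial is a polynomial function. -/
theorem HasMoments.exists_secondary_polynomial {I : Set ℝ} {w : ℝ → ℝ} (h : HasMoments I w)
    (p : ℝ[X]) : ∃ q : ℝ[X], ∀ x, secondaryFun I w p x = q.eval x := by
  induction p using Polynomial.induction_on' with
  | add p q hp hq =>
    obtain ⟨P, hP⟩ := hp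
    obtain ⟨Q, hQ⟩ := hq
    exact ⟨P + Q, fun x => by rw [h.secondaryFun_add, hP, hQ, eval_add]⟩
  | monomial n a =>
    refine ⟨∑ k ∈ Finset.range n, C (a * ∫ t in I, t ^ k * w t) * X ^ (n - 1 - k), fun x => ?_⟩
    have h1 : secondaryFun I w (monomial n a) x =
        ∫ t in I, ∑ k ∈ Finset.range n, (a * x ^ (n - 1 - k)) * (t ^ k * w t) := by
      refine integral_congr_ae ?_
      filter_upwards [ae_ne I x] with t ht
      have h2 := geom_sum₂_mul t x n
      have h3 : (∑ k ∈ Finset.range n, t ^ k * x ^ (n - 1 - k)) = (t ^ n - x ^ n) / (t - x) := by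
        rw [← h2, mul_div_cancel_right₀ _ (sub_ne_zero.mpr ht)]
      simp only [eval_monomial]
      rw [← mul_sub, mul_div_assoc, ← h3, Finset.mul_sum, Finset.sum_mul]
      exact Finset.sum_congr rfl fun k _ => by ring
    rw [h1, integral_finsetSum _ fun k _ => (h k).const_mul _, eval_finsetSum]
    refine Finset.sum_congr rfl fun k _ => ?_
    rw [integral_const_mul]
    simp only [eval_mul, eval_C, eval_pow, eval_X]
    ring

theorem HasMoments.memLp_secondaryFun {I : Set ℝ} {w v : ℝ → ℝ} (hw : HasMoments I w)
    (hv : HasMoments I v) (p : ℝ[X]) :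
    MemLp (secondaryFun I w p) 2 (densityMeasure I v) := by
  obtain ⟨q, hq⟩ := hw.exists_secondary_polynomial p
  rw [funext hq]
  exact hv.memLp_eval q

/-- The map sending a polynomial to its class in `L²(I, w)`. -/
def polyToL2 {I : Set ℝ} {w : ℝ → ℝ} (h : HasMoments I w) : ℝ[X] →ₗ[ℝ] L2 I w where
  toFun p := (h.memLp_eval p).toLp (fun t => p.eval t)
  map_add' p q := by
    rw [← MemLp.toLp_add]
    exact MemLp.toLp_congr _ _ (Eventually.of_forall fun t => by simp)
  map_smul' a p := by
    rw [RingHom.id_apply, ← MemLp.toLp_const_smul]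
    exact MemLp.toLp_congr _ _ (Eventually.of_forall fun t => by simp)

/-- The map sending a polynomial `p` to the class in `L²(I, v)` of its secondary polynomial with
respect to the density `w`. -/
def secondaryToL2 {I : Set ℝ} {w v : ℝ → ℝ} (hw : HasMoments I w) (hv : HasMoments I v) :
    ℝ[X] →ₗ[ℝ] L2 I v where
  toFun p := (hw.memLp_secondaryFun hv p).toLp (secondaryFun I w p)
  map_add' p q := by
    rw [← MemLp.toLp_add]
    exact MemLp.toLp_congr _ _ (Eventually.of_forall fun x => by simp [hw.secondaryFun_add])
  map_smul' a p := by
    rw [RingHom.id_apply, ← MemLp.toLp_const_smul]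
    exact MemLp.toLp_congr _ _ (Eventually.of_forall fun x => by simp [secondaryFun_smul])

/-- The operator `T_ρ : L²(I, ρ) → L²(I, μ)`: the extension by density and continuity of the
operator creating secondary polynomials. -/
def secondaryOperator {I : Set ℝ} {ρ μ : ℝ → ℝ} (hρ : HasMoments I ρ) (hμ : HasMoments I μ) :
    L2 I ρ →L[ℝ] L2 I μ :=
  (secondaryToL2 hρ hμ).extendOfNorm (polyToL2 hρ)

/-- Standing assumptions on `ρ`: a probability density on the interval `I`, continuous
(integrable singularities at the endpoints being allowed), with moments of any order, for which
the polynomials are dense in `L²(I, ρ)`. -/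
structure IsAdmissibleDensity (I : Set ℝ) (ρ : ℝ → ℝ) : Prop where
  nonneg : ∀ t ∈ I, 0 ≤ ρ t
  continuousOn : ContinuousOn ρ (interior I)
  integral_eq_one : ∫ t in I, ρ t = 1
  hasMoments : HasMoments I ρ
  dense : DenseRange (polyToL2 hasMoments)

/-- `μ` is the density of a secondary measure of `ρ`: a positive measure on `I` with moments of any
order such that `S_μ(z) = z - c₁ - 1 / S_ρ(z)`, where `c₁` is the mean of `ρ`. -/
structure IsSecondaryDensity (I : Set ℝ) (ρ μ : ℝ → ℝ) : Prop where
  nonneg : ∀ t ∈ I, 0 ≤ μ t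
  hasMoments : HasMoments I μ
  stieltjes_eq : ∀ z : ℂ, z ∉ ((↑) : ℝ → ℂ) '' closure I →
    stieltjes I μ z = z - ((∫ t in I, t * ρ t : ℝ) : ℂ) - 1 / stieltjes I ρ z

/-- `2 ∫_I (x - t) ρ(t) dt / ((x - t)² + ε²)`. -/
def reducerApprox (I : Set ℝ) (ρ : ℝ → ℝ) (ε x : ℝ) : ℝ :=
  2 * ∫ t in I, (x - t) * ρ t / ((x - t) ^ 2 + ε ^ 2)

/-- The limit defining the reducer of `ρ` exists at almost every point of `I`. -/
def ReducerExists (I : Set ℝ) (ρ : ℝ → ℝ) : Prop :=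
  ∀ᵐ x ∂(volume.restrict I), ∃ l : ℝ,
    Tendsto (fun ε : ℝ => reducerApprox I ρ ε x) (𝓝[>] 0) (𝓝 l)

/-- The reducer `φ` of `ρ`: the pointwise limit of `reducerApprox I ρ ε` as `ε → 0⁺`. -/
def reducer (I : Set ℝ) (ρ : ℝ → ℝ) (x : ℝ) : ℝ :=
  limUnder (𝓝[>] (0 : ℝ)) (fun ε : ℝ => reducerApprox I ρ ε x)

/-- `ρ` is reducible: its reducer is also the limit in the norm of `L²(I, ρ)`, and the quotient
`ρ / μ` belongs to the image of `T_ρ` (as an element of `L²(I, μ)`). -/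
structure IsReducible {I : Set ℝ} {ρ μ : ℝ → ℝ} (hρ : HasMoments I ρ) (hμ : HasMoments I μ) :
    Prop where
  memLp_reducer : MemLp (reducer I ρ) 2 (densityMeasure I ρ)
  tendsto_reducer : Tendsto
    (fun ε : ℝ => eLpNorm (fun x => reducerApprox I ρ ε x - reducer I ρ x) 2 (densityMeasure I ρ))
    (𝓝[>] 0) (𝓝 0)
  quotient_mem_range : ∃ g : L2 I ρ,
    (secondaryOperator hρ hμ g : ℝ → ℝ) =ᵐ[densityMeasure I μ] fun x => ρ x / μ x

end SecondaryMeasure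

end

noncomputable section

namespace SecondaryMeasure

/-! ### Integration against `densityMeasure` -/

/-! Both sides are continuous linear functionals of `f`, so they need only agree on polynomials. The
left side is the inner product with `φ` in `L²(I, ρ)`. Since `ρ / μ` is the class of some `T g`, the
right side is the inner product of `T f` with `T g` in `L²(I, μ)`.

For a polynomial `p`, put the regularised kernel `2(x-t)/((x-t)²+ε²)` in place of `φ`. The kernel is
odd, so exchanging `x` and `t` turns the double integral into that of
`(p(t)-p(x))(t-x)/((t-x)²+ε²)`, which is dominated by the difference quotient of `p` and tends to it
as `ε → 0⁺` (`integral_eval_mul_reducer`).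

Two facts support this. The operator is bounded, because `‖T p‖² = ‖p‖² - (∫ p ρ)²`, an identity
read off from the expansion of Stieltjes transforms at infinity (`integral_secondaryFun_mul`).
Integrals against `ρ` of classes modulo `μ` make sense, because `ρ = 0` almost everywhere where `μ =
0` (`ae_secondary_pos`): where `ρ > 0` and the reducer exists, `S_ρ` is bounded with imaginary part
away from `0`, so `-Im S_μ`, the Poisson integral of `μ`, is bounded below, which can happen only on
a Lebesgue-null part of a `μ`-null set. -/

theorem integrable_densityMeasure_iff {I : Set ℝ} {w : ℝ → ℝ} (hI : MeasurableSet I)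
    (hw : AEMeasurable w (volume.restrict I)) (hn : ∀ t ∈ I, 0 ≤ w t) (g : ℝ → ℝ) :
    Integrable g (densityMeasure I w) ↔ IntegrableOn (fun t => g t * w t) I := by
  rw [densityMeasure, integrable_withDensity_iff_integrable_smul₀' hw.ennreal_ofReal
    (Eventually.of_forall fun t => ENNReal.ofReal_lt_top)]
  refine integrable_congr ?_
  filter_upwards [ae_restrict_mem hI] with t ht
  rw [ENNReal.toReal_ofReal (hn t ht), smul_eq_mul, mul_comm]

theorem integral_densityMeasure {I : Set ℝ} {w : ℝ → ℝ} (hI : MeasurableSet I)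
    (hw : AEMeasurable w (volume.restrict I)) (hn : ∀ t ∈ I, 0 ≤ w t) (g : ℝ → ℝ) :
    ∫ t, g t ∂(densityMeasure I w) = ∫ t in I, g t * w t := by
  rw [densityMeasure, integral_withDensity_eq_integral_toReal_smul₀ hw.ennreal_ofReal
    (Eventually.of_forall fun t => ENNReal.ofReal_lt_top)]
  refine integral_congr_ae ?_
  filter_upwards [ae_restrict_mem hI] with t ht
  rw [ENNReal.toReal_ofReal (hn t ht), smul_eq_mul, mul_comm]

/-! ### Behaviour of Stieltjes transforms along the imaginary axis -/

theorem abs_im_le_norm_sub_ofReal (z : ℂ) (t : ℝ) : |z.im| ≤ ‖z - (t : ℂ)‖ := by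
  simpa using Complex.abs_im_le_norm (z - (t : ℂ))

theorem sub_ofReal_ne_zero {z : ℂ} (hz : z.im ≠ 0) (t : ℝ) : z - (t : ℂ) ≠ 0 := by
  intro h
  exact hz (by simpa using congrArg Complex.im h)

theorem integrableOn_stieltjes {I : Set ℝ} {w : ℝ → ℝ} (hw : IntegrableOn w I) {z : ℂ}
    (hz : z.im ≠ 0) : IntegrableOn (fun t : ℝ => (w t : ℂ) / (z - (t : ℂ))) I := by
  have hc : Continuous fun t : ℝ => (z - (t : ℂ))⁻¹ :=
    (by fun_prop : Continuous fun t : ℝ => z - (t : ℂ)).inv₀ (sub_ofReal_ne_zero hz)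
  refine (hw.ofReal (𝕜 := ℂ)).mul_bdd (c := |z.im|⁻¹) hc.aestronglyMeasurable
    (Eventually.of_forall fun t => ?_)
  rw [norm_inv]
  exact inv_anti₀ (abs_pos.mpr hz) (abs_im_le_norm_sub_ofReal z t)

/-- With `z = iy`, the factor `z / (z - t)` tends to `1` and has modulus at most `1`, so dominated
convergence applies. This recovers integrals from Stieltjes transforms. -/
theorem tendsto_mul_stieltjes {I : Set ℝ} {w : ℝ → ℝ} (hw : IntegrableOn w I) :
    Tendsto (fun y : ℝ => (y * Complex.I : ℂ) * stieltjes I w (y * Complex.I)) atTop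
      (𝓝 ((∫ t in I, w t : ℝ) : ℂ)) := by
  have hw' : IntegrableOn (fun t => (w t : ℂ)) I := hw.ofReal
  rw [← integral_complex_ofReal]
  simp only [stieltjes, ← integral_const_mul]
  refine tendsto_integral_filter_of_dominated_convergence (fun t => ‖w t‖) ?_ ?_ hw.norm ?_
  · filter_upwards [eventually_gt_atTop 0] with y hy
    exact ((integrableOn_stieltjes hw (z := y * Complex.I) (by simpa using hy.ne')).const_mul
      _).aestronglyMeasurable
  · filter_upwards [eventually_gt_atTop 0] with y hy
    refine Eventually.of_forall fun t => ?_
    have h := abs_im_le_norm_sub_ofReal (y * Complex.I) t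
    have hpos : 0 < ‖(y * Complex.I : ℂ) - t‖ := lt_of_lt_of_le (by simpa using hy.ne') h
    rw [norm_mul, norm_div, Complex.norm_real, mul_div_left_comm]
    refine mul_le_of_le_one_right (norm_nonneg _) ((div_le_one hpos).mpr ?_)
    simpa using h
  · refine Eventually.of_forall fun t => ?_
    have h1 : Tendsto (fun y : ℝ => (t : ℂ) / (y * Complex.I)) atTop (𝓝 0) := by
      rw [tendsto_zero_iff_norm_tendsto_zero]
      simp only [norm_div, norm_mul, Complex.norm_I, mul_one, Complex.norm_real]
      exact tendsto_const_nhds.div_atTop tendsto_norm_atTop_atTop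
    have h2 : Tendsto (fun y : ℝ => (w t : ℂ) / (1 - (t : ℂ) / (y * Complex.I))) atTop
        (𝓝 ((w t : ℂ) / (1 - 0))) :=
      tendsto_const_nhds.div (tendsto_const_nhds.sub h1) (by simp)
    rw [sub_zero, div_one] at h2
    refine h2.congr' ?_
    filter_upwards [eventually_gt_atTop 0] with y hy
    have hne : (y * Complex.I : ℂ) ≠ 0 := by simp [hy.ne']
    have hne2 := sub_ofReal_ne_zero (z := y * Complex.I) (by simpa using hy.ne') t
    rw [one_sub_div hne]
    field_simp

/-- If `R ≠ 0` then `X * R` has positive degree and is unbounded along the imaginary axis. -/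
theorem eq_zero_of_tendsto_mul_aeval {R : ℝ[X]} {L : ℂ}
    (h : Tendsto (fun y : ℝ => (y * Complex.I : ℂ) * aeval (y * Complex.I : ℂ) R) atTop (𝓝 L)) :
    L = 0 := by
  by_cases hR : R = 0
  · subst hR
    simp only [map_zero, mul_zero] at h
    exact tendsto_nhds_unique h tendsto_const_nhds
  · exfalso
    have hdeg : 0 < ((X * R).map (algebraMap ℝ ℂ)).degree := by
      rw [degree_map, degree_mul, degree_X]
      have := zero_le_degree_iff.mpr hR
      exact lt_of_lt_of_le (by decide) (add_le_add le_rfl this)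
    have hz : Tendsto (fun y : ℝ => ‖(y * Complex.I : ℂ)‖) atTop atTop := by
      simpa using tendsto_abs_atTop_atTop (G := ℝ)
    have h2 := Polynomial.tendsto_norm_atTop _ hdeg hz
    refine not_tendsto_nhds_of_tendsto_atTop h2 ‖L‖ ?_
    simpa [eval_map_algebraMap] using h.norm

/-! ### Secondary polynomials off the real line -/

theorem HasMoments.eval_mul_weight {I : Set ℝ} {w : ℝ → ℝ} (h : HasMoments I w) (p : ℝ[X]) :
    HasMoments I (fun t => p.eval t * w t) := by
  intro n
  refine (h.integrableOn_eval_mul (X ^ n * p)).congr (Eventually.of_forall fun t => ?_)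
  simp [mul_assoc]

theorem HasMoments.integrableOn {I : Set ℝ} {w : ℝ → ℝ} (h : HasMoments I w) :
    IntegrableOn w I := by
  simpa using h 0

/-- The left side is the integral of `(p(z) - p(t)) / (z - t) * w t`, and for monomials this
quotient is a geometric sum. The weight may change sign, so the result also applies to a polynomial
times `ρ`. -/
theorem HasMoments.exists_aeval_mul_stieltjes {I : Set ℝ} {w : ℝ → ℝ} (h : HasMoments I w)
    (p : ℝ[X]) : ∃ q : ℝ[X], (∀ x, secondaryFun I w p x = q.eval x) ∧ ∀ z : ℂ, z.im ≠ 0 →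
      aeval z p * stieltjes I w z - stieltjes I (fun t => p.eval t * w t) z = aeval z q := by
  induction p using Polynomial.induction_on' with
  | add p q hp hq =>
    obtain ⟨P, hP, hP'⟩ := hp
    obtain ⟨Q, hQ, hQ'⟩ := hq
    refine ⟨P + Q, fun x => by rw [h.secondaryFun_add, hP, hQ, eval_add], fun z hz => ?_⟩
    have h1 : stieltjes I (fun t => (p + q).eval t * w t) z =
        stieltjes I (fun t => p.eval t * w t) z + stieltjes I (fun t => q.eval t * w t) z := by
      unfold stieltjes
      rw [← integral_add (integrableOn_stieltjes (h.integrableOn_eval_mul p) hz)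
        (integrableOn_stieltjes (h.integrableOn_eval_mul q) hz)]
      congr 1
      ext t
      push_cast [eval_add]
      ring
    rw [h1, map_add, map_add, ← hP' z hz, ← hQ' z hz]
    ring
  | monomial n a =>
    have hsum : ∀ {K : Type} [Field K] (t x : K), t ≠ x →
        (∑ k ∈ Finset.range n, t ^ k * x ^ (n - 1 - k)) = (t ^ n - x ^ n) / (t - x) := by
      intro K _ t x htx
      rw [← geom_sum₂_mul t x n, mul_div_cancel_right₀ _ (sub_ne_zero.mpr htx)]
    refine ⟨∑ k ∈ Finset.range n, C (a * ∫ t in I, t ^ k * w t) * X ^ (n - 1 - k),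
      fun x => ?_, fun z hz => ?_⟩
    · have h1 : secondaryFun I w (monomial n a) x =
          ∫ t in I, ∑ k ∈ Finset.range n, (a * x ^ (n - 1 - k)) * (t ^ k * w t) := by
        refine integral_congr_ae ?_
        filter_upwards [ae_ne I x] with t ht
        simp only [eval_monomial]
        rw [← mul_sub, mul_div_assoc, ← hsum t x ht, Finset.mul_sum, Finset.sum_mul]
        exact Finset.sum_congr rfl fun k _ => by ring
      rw [h1, integral_finsetSum _ fun k _ => (h k).const_mul _, eval_finsetSum]
      refine Finset.sum_congr rfl fun k _ => ?_
      rw [integral_const_mul]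
      rw [eval_mul, eval_C, eval_pow, eval_X]
      ring
    · have h1 : aeval z (monomial n a) * stieltjes I w z
          - stieltjes I (fun t => (monomial n a).eval t * w t) z =
          ∫ t in I, ∑ k ∈ Finset.range n, ((a : ℂ) * z ^ (n - 1 - k)) * ((t ^ k * w t : ℝ) : ℂ) := by
        unfold stieltjes
        rw [← integral_const_mul, ← integral_sub
          ((integrableOn_stieltjes h.integrableOn hz).const_mul _)
          (integrableOn_stieltjes (h.integrableOn_eval_mul _) hz)]
        congr 1
        ext t
        have hne := sub_ofReal_ne_zero hz t
        have hne' : (t : ℂ) - z ≠ 0 := by rw [← neg_sub]; exact neg_ne_zero.mpr hne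
        have h3 : ∑ k ∈ Finset.range n, ((a : ℂ) * z ^ (n - 1 - k)) * ((t ^ k * w t : ℝ) : ℂ) =
            a * w t * ∑ k ∈ Finset.range n, (t : ℂ) ^ k * z ^ (n - 1 - k) := by
          rw [Finset.mul_sum]
          refine Finset.sum_congr rfl fun k _ => ?_
          push_cast
          ring
        rw [h3, hsum _ _ (sub_ne_zero.mp hne'), aeval_monomial, eval_monomial]
        push_cast
        rw [Complex.coe_algebraMap, ← neg_sub z (t : ℂ)]
        field_simp
        ring
      have hi : ∀ k ∈ Finset.range n, Integrable
          (fun t : ℝ => ((a : ℂ) * z ^ (n - 1 - k)) * ((t ^ k * w t : ℝ) : ℂ))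
          (volume.restrict I) := fun k _ => ((h k).ofReal (𝕜 := ℂ)).const_mul _
      rw [h1, integral_finsetSum _ hi, map_sum]
      refine Finset.sum_congr rfl fun k _ => ?_
      rw [integral_const_mul, integral_complex_ofReal]
      simp only [map_mul, aeval_C, map_pow, aeval_X, Complex.coe_algebraMap]
      ring

/-! ### Boundedness of the operator creating secondary polynomials -/

theorem im_ofReal_mul_I_ne_zero {y : ℝ} (hy : 0 < y) : ((y : ℂ) * Complex.I).im ≠ 0 := by
  simpa using hy.ne'

theorem notMem_ofReal_image {z : ℂ} (hz : z.im ≠ 0) (s : Set ℝ) :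
    z ∉ ((↑) : ℝ → ℂ) '' s := by
  rintro ⟨t, -, rfl⟩
  exact hz (Complex.ofReal_im t)

/-- Write `S_p` for the transform of `p ρ`, so that `P = p S_ρ - S_p` and `Q = q S_ρ - S_q` off the
real line. Substituting `S_μ = z - c - 1 / S_ρ` shows that `S_{PQμ} - S_{pqρ} + S_p S_q / S_ρ` is a
polynomial. Multiplied by `z`, it has a finite limit along the imaginary axis, so that limit is `0`.
-/
theorem integral_secondaryFun_mul {I : Set ℝ} {ρ μ : ℝ → ℝ} (hρ : HasMoments I ρ)
    (h1 : ∫ t in I, ρ t = 1) (hμ : IsSecondaryDensity I ρ μ) (p q : ℝ[X]) :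
    ∫ x in I, secondaryFun I ρ p x * secondaryFun I ρ q x * μ x =
      (∫ x in I, p.eval x * q.eval x * ρ x)
        - (∫ x in I, p.eval x * ρ x) * ∫ x in I, q.eval x * ρ x := by
  obtain ⟨P, hP, hP'⟩ := hρ.exists_aeval_mul_stieltjes p
  obtain ⟨Q, hQ, hQ'⟩ := hρ.exists_aeval_mul_stieltjes q
  obtain ⟨R₁, -, hR₁⟩ := hμ.hasMoments.exists_aeval_mul_stieltjes (P * Q)
  obtain ⟨R₂, -, hR₂⟩ := hρ.exists_aeval_mul_stieltjes (p * q)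
  obtain ⟨R₃, -, hR₃⟩ := (hρ.eval_mul_weight q).exists_aeval_mul_stieltjes p
  obtain ⟨R₄, -, hR₄⟩ := (hρ.eval_mul_weight p).exists_aeval_mul_stieltjes q
  have e3 : (fun t => p.eval t * (q.eval t * ρ t)) = fun t => (p * q).eval t * ρ t := by
    ext t; rw [eval_mul]; ring
  have e4 : (fun t => q.eval t * (p.eval t * ρ t)) = fun t => (p * q).eval t * ρ t := by
    ext t; rw [eval_mul]; ring
  rw [e3] at hR₃
  rw [e4] at hR₄
  set c : ℝ := ∫ t in I, t * ρ t with hc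
  have tS := tendsto_mul_stieltjes hρ.integrableOn
  rw [h1, Complex.ofReal_one] at tS
  have tp := tendsto_mul_stieltjes (hρ.integrableOn_eval_mul p)
  have tq := tendsto_mul_stieltjes (hρ.integrableOn_eval_mul q)
  have tpq := tendsto_mul_stieltjes (hρ.integrableOn_eval_mul (p * q))
  have tM := tendsto_mul_stieltjes (hμ.hasMoments.integrableOn_eval_mul (P * Q))
  -- Dividing `(z S_p)(z S_q)` by `z S_ρ`, which tends to `1`, leaves exactly one factor `z` in
  -- front of `S_p S_q / S_ρ`.
  have key := (tM.sub tpq).add ((tp.mul tq).div tS one_ne_zero)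
  have hzero := eq_zero_of_tendsto_mul_aeval
    (R := P * Q * (X - C c) - R₁ - R₂ + R₃ + R₄) (key.congr' ?_)
  · rw [div_one] at hzero
    have hre : (∫ x in I, (P * Q).eval x * μ x) - (∫ x in I, (p * q).eval x * ρ x)
        + (∫ x in I, p.eval x * ρ x) * ∫ x in I, q.eval x * ρ x = 0 := by
      exact_mod_cast hzero
    simp only [eval_mul] at hre
    simp only [hP, hQ]
    linarith
  · filter_upwards [eventually_gt_atTop 0, tS.eventually_ne one_ne_zero] with y hy hS
    have hz := im_ofReal_mul_I_ne_zero hy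
    have hst := hμ.stieltjes_eq _ (notMem_ofReal_image hz _)
    simp only [Pi.div_apply]
    generalize (y : ℂ) * Complex.I = z at *
    have hS0 : stieltjes I ρ z ≠ 0 := right_ne_zero_of_mul hS
    have hz0 : z ≠ 0 := left_ne_zero_of_mul hS
    have a1 := hR₁ z hz
    have a2 := hR₂ z hz
    have a3 := hR₃ z hz
    have a4 := hR₄ z hz
    simp only [map_add, map_sub, map_mul, aeval_X, aeval_C, Complex.coe_algebraMap] at *
    rw [← a1, ← a2, ← a3, ← a4, hst, ← hP' z hz, ← hQ' z hz]
    field_simp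
    ring

theorem norm_polyToL2_sq {I : Set ℝ} {w : ℝ → ℝ} (hI : MeasurableSet I)
    (hn : ∀ t ∈ I, 0 ≤ w t) (h : HasMoments I w) (p : ℝ[X]) :
    ‖polyToL2 h p‖ ^ 2 = ∫ x in I, p.eval x * p.eval x * w x := by
  rw [← real_inner_self_eq_norm_sq, L2.inner_def,
    ← integral_densityMeasure hI h.aemeasurable hn fun x => p.eval x * p.eval x]
  refine integral_congr_ae ?_
  filter_upwards [(h.memLp_eval p).coeFn_toLp] with x hx
  simp only [polyToL2, LinearMap.coe_mk, AddHom.coe_mk, hx]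
  simp [sq]

theorem norm_secondaryToL2_sq {I : Set ℝ} {w v : ℝ → ℝ} (hI : MeasurableSet I)
    (hw : HasMoments I w) (hv : HasMoments I v) (hn : ∀ t ∈ I, 0 ≤ v t) (p : ℝ[X]) :
    ‖secondaryToL2 hw hv p‖ ^ 2 =
      ∫ x in I, secondaryFun I w p x * secondaryFun I w p x * v x := by
  rw [← real_inner_self_eq_norm_sq, L2.inner_def,
    ← integral_densityMeasure hI hv.aemeasurable hn fun x =>
      secondaryFun I w p x * secondaryFun I w p x]
  refine integral_congr_ae ?_
  filter_upwards [(hw.memLp_secondaryFun hv p).coeFn_toLp] with x hx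
  simp only [secondaryToL2, LinearMap.coe_mk, AddHom.coe_mk, hx]
  simp [sq]

theorem norm_secondaryToL2_le {I : Set ℝ} {ρ μ : ℝ → ℝ} (hI : MeasurableSet I)
    (hρ : IsAdmissibleDensity I ρ) (hμ : IsSecondaryDensity I ρ μ) (p : ℝ[X]) :
    ‖secondaryToL2 hρ.hasMoments hμ.hasMoments p‖ ≤ ‖polyToL2 hρ.hasMoments p‖ := by
  rw [← sq_le_sq₀ (norm_nonneg _) (norm_nonneg _),
    norm_secondaryToL2_sq hI _ _ hμ.nonneg, norm_polyToL2_sq hI hρ.nonneg,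
    integral_secondaryFun_mul hρ.hasMoments hρ.integral_eq_one hμ]
  nlinarith [mul_self_nonneg (∫ x in I, p.eval x * ρ x)]

/-- This is what makes `T` well defined: `extendOfNorm` agrees with the original map once
polynomials are dense and a norm bound holds, here with constant `1`. -/
theorem secondaryOperator_polyToL2 {I : Set ℝ} {ρ μ : ℝ → ℝ} (hI : MeasurableSet I)
    (hρ : IsAdmissibleDensity I ρ) (hμ : IsSecondaryDensity I ρ μ) (p : ℝ[X]) :
    secondaryOperator hρ.hasMoments hμ.hasMoments (polyToL2 hρ.hasMoments p) =
      secondaryToL2 hρ.hasMoments hμ.hasMoments p :=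
  LinearMap.extendOfNorm_eq hρ.dense
    ⟨1, fun q => by simpa using norm_secondaryToL2_le hI hρ hμ q⟩ p

/-! ### The reducer tested against polynomials -/

theorem integrable_prod_quotient {ν : Measure ℝ} [SFinite ν]
    (hν : ∀ p : ℝ[X], Integrable (fun t => p.eval t) ν) (p : ℝ[X]) :
    Integrable (fun z : ℝ × ℝ => (p.eval z.2 - p.eval z.1) / (z.2 - z.1)) (ν.prod ν) := by
  have hmeas : ∀ q : ℝ[X],
      Measurable fun z : ℝ × ℝ => (q.eval z.2 - q.eval z.1) / (z.2 - z.1) := fun q => by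
    have hq : Measurable fun t : ℝ => q.eval t := q.continuous.measurable
    exact ((hq.comp measurable_snd).sub (hq.comp measurable_fst)).div
      (measurable_snd.sub measurable_fst)
  induction p using Polynomial.induction_on' with
  | add p q hp hq =>
    refine (hp.add hq).congr (Eventually.of_forall fun z => ?_)
    simp only [Pi.add_apply, eval_add]
    ring
  | monomial n a =>
    have hX : ∀ k : ℕ, Integrable (fun t : ℝ => |t| ^ k) ν := fun k =>
      (hν (X ^ k)).norm.congr (Eventually.of_forall fun t => by simp)
    -- The quotient of a monomial is a geometric sum, dominated by products of absolute moments. On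
    -- the diagonal the quotient is `0` by convention.
    have hb : Integrable (fun z : ℝ × ℝ => |a| * ∑ k ∈ Finset.range n,
        |z.1| ^ (n - 1 - k) * |z.2| ^ k) (ν.prod ν) :=
      (integrable_finsetSum _ fun k _ => (hX (n - 1 - k)).mul_prod (hX k)).const_mul _
    refine hb.mono' (hmeas _).aestronglyMeasurable (Eventually.of_forall fun z => ?_)
    by_cases hz : z.2 = z.1
    · simp only [hz, sub_self, div_zero, norm_zero]
      positivity
    · have h3 : (∑ k ∈ Finset.range n, z.2 ^ k * z.1 ^ (n - 1 - k)) =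
          (z.2 ^ n - z.1 ^ n) / (z.2 - z.1) := by
        rw [← geom_sum₂_mul z.2 z.1 n, mul_div_cancel_right₀ _ (sub_ne_zero.mpr hz)]
      simp only [eval_monomial]
      rw [← mul_sub, mul_div_assoc, ← h3, norm_mul, Real.norm_eq_abs, Real.norm_eq_abs]
      refine mul_le_mul_of_nonneg_left ((Finset.abs_sum_le_sum_abs _ _).trans_eq ?_) (abs_nonneg _)
      refine Finset.sum_congr rfl fun k _ => ?_
      rw [abs_mul, abs_pow, abs_pow, mul_comm]

theorem abs_conjugate_kernel_le {ε : ℝ} (hε : 0 < ε) (u : ℝ) : |u / (u ^ 2 + ε ^ 2)| ≤ ε⁻¹ := by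
  have hpos : 0 < u ^ 2 + ε ^ 2 := by positivity
  rw [abs_div, abs_of_pos hpos, div_le_iff₀ hpos, inv_mul_eq_div, le_div_iff₀ hε]
  nlinarith [sq_abs u, sq_nonneg (|u| - ε), sq_nonneg u]

/-- The factor `2` splits into two copies of the double integral. Exchanging the variables in one of
them and using that the kernel is odd produces the difference `p z.2 - p z.1`. -/
theorem integral_mul_conjugate_kernel {ν : Measure ℝ} [IsFiniteMeasure ν] {p : ℝ → ℝ}
    (hp : Integrable p ν) {ε : ℝ} (hε : 0 < ε) :
    ∫ x, p x * (2 * ∫ t, (x - t) / ((x - t) ^ 2 + ε ^ 2) ∂ν) ∂ν =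
      ∫ z : ℝ × ℝ, (p z.2 - p z.1) * ((z.2 - z.1) / ((z.2 - z.1) ^ 2 + ε ^ 2)) ∂(ν.prod ν) := by
  have hK : Measurable fun z : ℝ × ℝ => (z.1 - z.2) / ((z.1 - z.2) ^ 2 + ε ^ 2) := by fun_prop
  have hH : Integrable (fun z : ℝ × ℝ => p z.1 * ((z.1 - z.2) / ((z.1 - z.2) ^ 2 + ε ^ 2)))
      (ν.prod ν) :=
    (hp.comp_fst ν).mul_bdd (c := ε⁻¹) hK.aestronglyMeasurable
      (Eventually.of_forall fun z => abs_conjugate_kernel_le hε _)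
  have h1 : ∫ x, p x * (2 * ∫ t, (x - t) / ((x - t) ^ 2 + ε ^ 2) ∂ν) ∂ν =
      2 * ∫ z : ℝ × ℝ, p z.1 * ((z.1 - z.2) / ((z.1 - z.2) ^ 2 + ε ^ 2)) ∂(ν.prod ν) := by
    rw [integral_prod _ hH, ← integral_const_mul]
    congr 1
    ext x
    simp only [integral_const_mul]
    ring
  have hS : Integrable (fun z : ℝ × ℝ => p z.2 * ((z.2 - z.1) / ((z.2 - z.1) ^ 2 + ε ^ 2)))
      (ν.prod ν) := hH.swap
  have h2 : ∫ z : ℝ × ℝ, p z.2 * ((z.2 - z.1) / ((z.2 - z.1) ^ 2 + ε ^ 2)) ∂(ν.prod ν) =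
      ∫ z : ℝ × ℝ, p z.1 * ((z.1 - z.2) / ((z.1 - z.2) ^ 2 + ε ^ 2)) ∂(ν.prod ν) :=
    integral_prod_swap (μ := ν) (ν := ν)
      (fun z : ℝ × ℝ => p z.1 * ((z.1 - z.2) / ((z.1 - z.2) ^ 2 + ε ^ 2)))
  rw [h1, two_mul]
  nth_rewrite 1 [← h2]
  rw [← integral_add hS hH]
  congr 1
  ext z
  rw [← neg_sub z.2 z.1]
  ring

/-- Dominated convergence after symmetrisation: `u² / (u² + ε²) ≤ 1` bounds the integrand by the
difference quotient, uniformly in `ε`. -/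
theorem tendsto_integral_mul_conjugate_kernel {ν : Measure ℝ} [IsFiniteMeasure ν]
    (hν : ∀ p : ℝ[X], Integrable (fun t => p.eval t) ν) (p : ℝ[X]) :
    Tendsto (fun ε : ℝ => ∫ x, p.eval x * (2 * ∫ t, (x - t) / ((x - t) ^ 2 + ε ^ 2) ∂ν) ∂ν)
      (𝓝[>] 0) (𝓝 (∫ x, ∫ t, (p.eval t - p.eval x) / (t - x) ∂ν ∂ν)) := by
  have hF := integrable_prod_quotient hν p
  have hpm : Measurable fun t : ℝ => p.eval t := p.continuous.measurable
  rw [← integral_prod (fun z : ℝ × ℝ => (p.eval z.2 - p.eval z.1) / (z.2 - z.1)) hF]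
  have h : Tendsto (fun ε : ℝ => ∫ z : ℝ × ℝ, (p.eval z.2 - p.eval z.1) *
      ((z.2 - z.1) / ((z.2 - z.1) ^ 2 + ε ^ 2)) ∂(ν.prod ν)) (𝓝[>] 0)
      (𝓝 (∫ z : ℝ × ℝ, (p.eval z.2 - p.eval z.1) / (z.2 - z.1) ∂(ν.prod ν))) := by
    refine tendsto_integral_filter_of_dominated_convergence
      (fun z => ‖(p.eval z.2 - p.eval z.1) / (z.2 - z.1)‖) ?_ ?_ hF.norm ?_
    · refine Eventually.of_forall fun ε => Measurable.aestronglyMeasurable ?_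
      exact ((hpm.comp measurable_snd).sub (hpm.comp measurable_fst)).mul (by fun_prop)
    · refine Eventually.of_forall fun ε => Eventually.of_forall fun z => ?_
      by_cases hz : z.2 - z.1 = 0
      · simp [hz]
      · rw [norm_mul, norm_div, norm_div, mul_div_assoc', div_le_div_iff₀]
        · rw [Real.norm_of_nonneg (by positivity : 0 ≤ (z.2 - z.1) ^ 2 + ε ^ 2), mul_assoc]
          refine mul_le_mul_of_nonneg_left ?_ (norm_nonneg _)
          rw [Real.norm_eq_abs, abs_mul_abs_self]
          nlinarith [sq_nonneg ε]
        · exact norm_pos_iff.mpr (by positivity)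
        · exact norm_pos_iff.mpr hz
    · refine Eventually.of_forall fun z => ?_
      by_cases hz : z.2 - z.1 = 0
      · simp [hz]
      · have hc : ContinuousAt (fun ε : ℝ => (p.eval z.2 - p.eval z.1) *
            ((z.2 - z.1) / ((z.2 - z.1) ^ 2 + ε ^ 2))) 0 := by
          have : (z.2 - z.1) ^ 2 + (0 : ℝ) ^ 2 ≠ 0 := by simpa using hz
          fun_prop (disch := assumption)
        have h2 := hc.tendsto.mono_left (nhdsWithin_le_nhds (s := Set.Ioi 0))
        convert h2 using 2
        field_simp
        simp
  refine h.congr' ?_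
  filter_upwards [self_mem_nhdsWithin] with ε hε
  exact (integral_mul_conjugate_kernel (hν p) hε).symm

theorem reducerApprox_eq {I : Set ℝ} {ρ : ℝ → ℝ} (hI : MeasurableSet I)
    (hn : ∀ t ∈ I, 0 ≤ ρ t) (h : HasMoments I ρ) (ε x : ℝ) :
    reducerApprox I ρ ε x =
      2 * ∫ t, (x - t) / ((x - t) ^ 2 + ε ^ 2) ∂(densityMeasure I ρ) := by
  rw [integral_densityMeasure hI h.aemeasurable hn, reducerApprox]
  simp only [div_mul_eq_mul_div]

theorem secondaryFun_eq {I : Set ℝ} {ρ : ℝ → ℝ} (hI : MeasurableSet I)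
    (hn : ∀ t ∈ I, 0 ≤ ρ t) (h : HasMoments I ρ) (p : ℝ[X]) (x : ℝ) :
    secondaryFun I ρ p x = ∫ t, (p.eval t - p.eval x) / (t - x) ∂(densityMeasure I ρ) := by
  rw [integral_densityMeasure hI h.aemeasurable hn, secondaryFun]

theorem HasMoments.isFiniteMeasure {I : Set ℝ} {w : ℝ → ℝ} (h : HasMoments I w) :
    IsFiniteMeasure (densityMeasure I w) :=
  isFiniteMeasure_withDensity_ofReal h.integrableOn.2

theorem integral_eval_mul_reducer {I : Set ℝ} {ρ : ℝ → ℝ} (hI : MeasurableSet I)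
    (hn : ∀ t ∈ I, 0 ≤ ρ t) (h : HasMoments I ρ)
    (hφ : MemLp (reducer I ρ) 2 (densityMeasure I ρ))
    (ht : Tendsto (fun ε : ℝ =>
      eLpNorm (fun x => reducerApprox I ρ ε x - reducer I ρ x) 2 (densityMeasure I ρ))
      (𝓝[>] 0) (𝓝 0)) (p : ℝ[X]) :
    ∫ x in I, p.eval x * reducer I ρ x * ρ x = ∫ x in I, secondaryFun I ρ p x * ρ x := by
  rw [← integral_densityMeasure hI h.aemeasurable hn fun x => p.eval x * reducer I ρ x,
    ← integral_densityMeasure hI h.aemeasurable hn]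
  have := h.isFiniteMeasure
  set ν := densityMeasure I ρ with hν
  have hint : ∀ p : ℝ[X], Integrable (fun t => p.eval t) ν := fun p =>
    (integrable_densityMeasure_iff hI h.aemeasurable hn _).mpr (h.integrableOn_eval_mul p)
  have hlim := tendsto_integral_mul_conjugate_kernel hint p
  simp only [secondaryFun_eq hI hn h]
  refine tendsto_nhds_unique ?_ hlim
  simp only [← reducerApprox_eq hI hn h, hν]
  have hmeas : ∀ ε, StronglyMeasurable (reducerApprox I ρ ε) := fun ε => by
    have hK : Measurable fun z : ℝ × ℝ => (z.1 - z.2) / ((z.1 - z.2) ^ 2 + ε ^ 2) := by fun_prop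
    have h2 := (hK.stronglyMeasurable.integral_prod_right' (ν := ν)).const_mul (2 : ℝ)
    rwa [← show reducerApprox I ρ ε = _ from funext fun x => reducerApprox_eq hI hn h ε x] at h2
  have hpL := h.memLp_eval p
  refine tendsto_integral_of_L1' _ (hφ.integrable_mul hpL |>.aestronglyMeasurable.congr
    (Eventually.of_forall fun x => mul_comm _ _)) ?_ ?_
  · filter_upwards [self_mem_nhdsWithin] with ε hε
    refine (hint p).mul_bdd (c := 2 * (ε⁻¹ * ν.real Set.univ)) (hmeas ε).aestronglyMeasurable
      (Eventually.of_forall fun x => ?_)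
    rw [reducerApprox_eq hI hn h, norm_mul, Real.norm_two]
    gcongr
    exact norm_integral_le_of_norm_le_const
      (Eventually.of_forall fun t => abs_conjugate_kernel_le hε _)
  -- By Hölder with exponents `2, 2, 1`, convergence to the reducer in `L²` gives convergence in
  -- `L¹` after multiplication by `p`.
  · have hub : Tendsto (fun ε : ℝ => eLpNorm (fun x => p.eval x) 2 ν *
        eLpNorm (fun x => reducerApprox I ρ ε x - reducer I ρ x) 2 ν) (𝓝[>] 0) (𝓝 0) := by
      simpa using ENNReal.Tendsto.const_mul ht (Or.inr hpL.eLpNorm_ne_top)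
    refine tendsto_of_tendsto_of_tendsto_of_le_of_le tendsto_const_nhds hub
      (fun _ => zero_le) fun ε => ?_
    refine le_trans (le_of_eq ?_) (eLpNorm_smul_le_mul_eLpNorm (p := 2) (q := 2) (r := 1)
      ((hmeas ε).aestronglyMeasurable.sub hφ.aestronglyMeasurable) hpL.aestronglyMeasurable)
    congr 1
    ext x
    simp [mul_sub]

/-! ### Poisson integrals -/

/-- The Poisson kernel is `π` times a Cauchy density of scale `ε`, hence its total mass is `π`. -/
theorem pi_mul_cauchyPDFReal (t : ℝ) {ε : ℝ} (hε : 0 < ε) (x : ℝ) :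
    Real.pi * ProbabilityTheory.cauchyPDFReal t ε.toNNReal x = ε / ((x - t) ^ 2 + ε ^ 2) := by
  rw [ProbabilityTheory.cauchyPDFReal_def, Real.coe_toNNReal ε hε.le]
  field_simp

theorem integrable_poisson (t : ℝ) {ε : ℝ} (hε : 0 < ε) :
    Integrable fun x : ℝ => ε / ((x - t) ^ 2 + ε ^ 2) :=
  ((ProbabilityTheory.integrable_cauchyPDFReal t (γ := ε.toNNReal)).const_mul Real.pi).congr
    (Eventually.of_forall fun x => pi_mul_cauchyPDFReal t hε x)

theorem integral_poisson (t : ℝ) {ε : ℝ} (hε : 0 < ε) :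
    ∫ x : ℝ, ε / ((x - t) ^ 2 + ε ^ 2) = Real.pi := by
  simp only [← pi_mul_cauchyPDFReal t hε]
  rw [integral_const_mul, ProbabilityTheory.integral_cauchyPDFReal_eq_one t
    (Real.toNNReal_pos.mpr hε).ne', mul_one]

theorem lintegral_poisson (t : ℝ) {ε : ℝ} (hε : 0 < ε) :
    ∫⁻ x : ℝ, ENNReal.ofReal (ε / ((x - t) ^ 2 + ε ^ 2)) = ENNReal.ofReal Real.pi := by
  rw [← integral_poisson t hε, ofReal_integral_eq_lintegral_ofReal (integrable_poisson t hε)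
    (Eventually.of_forall fun x => by positivity)]

theorem measurable_poisson (ε : ℝ) :
    Measurable fun z : ℝ × ℝ => ENNReal.ofReal (ε / ((z.1 - z.2) ^ 2 + ε ^ 2)) := by
  fun_prop

/-- The Poisson integrals of a finite measure tend to zero in mean on every compact null set of
that measure. -/
theorem tendsto_setLIntegral_poisson {M : Measure ℝ} [IsFiniteMeasure M] {K : Set ℝ}
    (hK : IsCompact K) (hMK : M K = 0) :
    Tendsto (fun ε : ℝ => ∫⁻ x in K, ∫⁻ t, ENNReal.ofReal (ε / ((x - t) ^ 2 + ε ^ 2)) ∂M)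
      (𝓝[>] 0) (𝓝 0) := by
  -- By Tonelli the kernel is integrated over `K` first. The result is at most `π`, and it tends to
  -- `0` at each `t` outside the closed set `K`, where the kernel is at most `ε / δ²`.
  have hswap : ∀ ε : ℝ, ∫⁻ x in K, ∫⁻ t, ENNReal.ofReal (ε / ((x - t) ^ 2 + ε ^ 2)) ∂M =
      ∫⁻ t, (∫⁻ x in K, ENNReal.ofReal (ε / ((x - t) ^ 2 + ε ^ 2))) ∂M := fun ε =>
    lintegral_lintegral_swap (measurable_poisson ε).aemeasurable
  simp only [hswap]
  rw [← lintegral_zero (μ := M)]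
  refine tendsto_lintegral_filter_of_dominated_convergence (fun _ => ENNReal.ofReal Real.pi)
    (Eventually.of_forall fun ε => ?_) ?_ ?_ ?_
  · exact ((measurable_poisson ε).comp measurable_swap).lintegral_prod_right'
  · filter_upwards [self_mem_nhdsWithin] with ε hε
    exact Eventually.of_forall fun t =>
      (setLIntegral_le_lintegral _ _).trans_eq (lintegral_poisson t hε)
  · rw [lintegral_const]
    exact ENNReal.mul_ne_top ENNReal.ofReal_ne_top (measure_ne_top _ _)
  · have hae : ∀ᵐ t ∂M, t ∉ K := measure_eq_zero_iff_ae_notMem.mp hMK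
    filter_upwards [hae] with t ht
    obtain ⟨δ, hδ, hball⟩ := Metric.isOpen_iff.mp hK.isClosed.isOpen_compl t ht
    have hlim : Tendsto (fun ε : ℝ => ENNReal.ofReal (ε / δ ^ 2) * volume K) (𝓝[>] 0) (𝓝 0) := by
      have h1 : Tendsto (fun ε : ℝ => ENNReal.ofReal (ε / δ ^ 2)) (𝓝[>] 0) (𝓝 0) := by
        have h2 : Continuous fun ε : ℝ => ENNReal.ofReal (ε / δ ^ 2) :=
          ENNReal.continuous_ofReal.comp (by fun_prop)
        simpa using (h2.tendsto 0).mono_left (nhdsWithin_le_nhds (s := Set.Ioi 0))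
      simpa using ENNReal.Tendsto.mul_const h1 (Or.inr hK.measure_lt_top.ne)
    refine tendsto_of_tendsto_of_tendsto_of_le_of_le' tendsto_const_nhds hlim
      (Eventually.of_forall fun _ => zero_le) ?_
    filter_upwards [self_mem_nhdsWithin] with ε hε
    have hε' : 0 < ε := hε
    rw [← setLIntegral_const]
    refine setLIntegral_mono measurable_const fun x hx => ENNReal.ofReal_le_ofReal ?_
    have hd : δ ≤ |x - t| := by
      by_contra! hlt
      exact hball (by rwa [Metric.mem_ball, Real.dist_eq]) hx
    have : δ ^ 2 ≤ (x - t) ^ 2 := by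
      rw [← sq_abs (x - t)]
      gcongr
    gcongr
    nlinarith [sq_nonneg ε]

/-- A null set of a finite measure at almost every point of which the Poisson integrals stay away
from zero is Lebesgue negligible. -/
theorem volume_eq_zero_of_poisson_pos {M : Measure ℝ} [IsFiniteMeasure M] {N : Set ℝ}
    (hMN : M N = 0) (h : ∀ᵐ x, x ∈ N → ∃ c > 0, ∀ᶠ ε : ℝ in 𝓝[>] 0,
      c ≤ ∫ t, ε / ((x - t) ^ 2 + ε ^ 2) ∂M) : volume N = 0 := by
  -- A sequence of values of `ε` keeps the lower limit `H` measurable and makes Fatou's lemma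
  -- available.
  set e : ℕ → ℝ := fun n => 1 / ((n : ℝ) + 1) with he
  have hpos : ∀ n, 0 < e n := fun n => by positivity
  have hlim : Tendsto e atTop (𝓝[>] 0) := tendsto_nhdsWithin_iff.mpr
    ⟨tendsto_one_div_add_atTop_nhds_zero_nat, Eventually.of_forall hpos⟩
  set F : ℕ → ℝ → ℝ≥0∞ := fun n x => ∫⁻ t, ENNReal.ofReal (e n / ((x - t) ^ 2 + e n ^ 2)) ∂M
    with hF
  have hFm : ∀ n, Measurable (F n) := fun n => (measurable_poisson (e n)).lintegral_prod_right'
  set H : ℝ → ℝ≥0∞ := fun x => liminf (fun n => F n x) atTop with hH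
  have hHm : Measurable H := Measurable.liminf hFm
  have hHpos : ∀ᵐ x, x ∈ N → 0 < H x := by
    filter_upwards [h] with x hx hxN
    obtain ⟨c, hc, hev⟩ := hx hxN
    refine (ENNReal.ofReal_pos.mpr hc).trans_le (le_liminf_of_le (by isBoundedDefault) ?_)
    filter_upwards [hlim.eventually hev] with n hn
    refine (ENNReal.ofReal_le_ofReal hn).trans ?_
    rw [integral_eq_lintegral_of_nonneg_ae]
    · exact ENNReal.ofReal_toReal_le
    · exact Eventually.of_forall fun t => by have := hpos n; positivity
    · exact Measurable.aestronglyMeasurable (by fun_prop)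
  -- `N` need not be measurable. A measurable hull of the same `M`-measure, cut down to `H > 0`,
  -- still contains almost all of `N` and can be tested on compact subsets.
  set N' : Set ℝ := toMeasurable M N ∩ {x | 0 < H x} with hN'
  have hN'm : MeasurableSet N' :=
    (measurableSet_toMeasurable _ _).inter (measurableSet_lt measurable_const hHm)
  have hvol : volume N' = 0 := by
    by_contra hne
    obtain ⟨K, hKN, hK, hKpos⟩ := hN'm.exists_lt_isCompact (pos_iff_ne_zero.mpr hne)
    have hMK : M K = 0 := measure_mono_null (hKN.trans Set.inter_subset_left)
      (by rwa [measure_toMeasurable])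
    have h1 : 0 < ∫⁻ x in K, H x := by
      rw [setLIntegral_pos_iff hHm]
      refine hKpos.trans_le (measure_mono fun x hx => ⟨?_, hx⟩)
      exact (hKN hx).2.ne'
    have h2 : ∫⁻ x in K, H x ≤ liminf (fun n => ∫⁻ x in K, F n x) atTop :=
      lintegral_liminf_le hFm
    have h3 : Tendsto (fun n => ∫⁻ x in K, F n x) atTop (𝓝 0) :=
      (tendsto_setLIntegral_poisson hK hMK).comp hlim
    rw [h3.liminf_eq] at h2
    exact h1.not_ge h2
  refine measure_mono_null_ae ?_ hvol
  filter_upwards [hHpos] with x hx hxN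
  exact ⟨subset_toMeasurable _ _ hxN, hx hxN⟩

/-! ### Boundary behaviour of Stieltjes transforms -/

theorem re_ofReal_div_sub (a t x ε : ℝ) :
    ((a : ℂ) / (((x : ℂ) + ε * Complex.I) - (t : ℂ))).re =
      (x - t) * a / ((x - t) ^ 2 + ε ^ 2) := by
  simp [Complex.div_re, Complex.normSq_apply]
  ring

theorem im_ofReal_div_sub (a t x ε : ℝ) :
    ((a : ℂ) / (((x : ℂ) + ε * Complex.I) - (t : ℂ))).im =
      -(ε * a / ((x - t) ^ 2 + ε ^ 2)) := by
  simp [Complex.div_im, Complex.normSq_apply]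
  ring

theorem re_stieltjes {I : Set ℝ} {w : ℝ → ℝ} (hw : IntegrableOn w I) (x : ℝ) {ε : ℝ}
    (hε : 0 < ε) : (stieltjes I w (x + ε * Complex.I)).re = reducerApprox I w ε x / 2 := by
  have hz : ((x : ℂ) + ε * Complex.I).im ≠ 0 := by simpa using hε.ne'
  rw [stieltjes, ← RCLike.re_eq_complex_re, ← integral_re (integrableOn_stieltjes hw hz),
    reducerApprox, mul_div_cancel_left₀ _ two_ne_zero]
  congr 1
  ext t
  exact re_ofReal_div_sub _ _ _ _

theorem im_stieltjes {I : Set ℝ} {w : ℝ → ℝ} (hw : IntegrableOn w I) (x : ℝ) {ε : ℝ}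
    (hε : 0 < ε) : (stieltjes I w (x + ε * Complex.I)).im =
      -∫ t in I, ε * w t / ((x - t) ^ 2 + ε ^ 2) := by
  have hz : ((x : ℂ) + ε * Complex.I).im ≠ 0 := by simpa using hε.ne'
  rw [stieltjes, ← RCLike.im_eq_complex_im, ← integral_im (integrableOn_stieltjes hw hz),
    ← integral_neg]
  congr 1
  ext t
  exact im_ofReal_div_sub _ _ _ _

theorem integrableOn_poisson_mul {I : Set ℝ} {w : ℝ → ℝ} (hw : IntegrableOn w I) (x : ℝ) {ε : ℝ}
    (hε : 0 < ε) : IntegrableOn (fun t => ε * w t / ((x - t) ^ 2 + ε ^ 2)) I := by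
  have hm : Measurable fun t : ℝ => ε / ((x - t) ^ 2 + ε ^ 2) := by fun_prop
  refine (hw.bdd_mul (c := ε⁻¹) hm.aestronglyMeasurable (Eventually.of_forall fun t => ?_)).congr
    (Eventually.of_forall fun t => by ring)
  rw [Real.norm_of_nonneg (by positivity), div_le_iff₀ (by positivity)]
  have : ε⁻¹ * ε ^ 2 = ε := by field_simp
  rw [mul_add, this]
  have : 0 ≤ ε⁻¹ * (x - t) ^ 2 := by positivity
  linarith

/-- The Poisson integral of a density stays between two positive constants near an interior point
at which the density is continuous and positive. -/
theorem eventually_poisson_bounds {I : Set ℝ} (hI : MeasurableSet I) {w : ℝ → ℝ}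
    (hw : IntegrableOn w I) (hn : ∀ t ∈ I, 0 ≤ w t) {x : ℝ} (hx : x ∈ interior I)
    (hc : ContinuousAt w x) (hpos : 0 < w x) :
    ∃ c > 0, ∃ C, ∀ᶠ ε : ℝ in 𝓝[>] 0,
      c ≤ ∫ t in I, ε * w t / ((x - t) ^ 2 + ε ^ 2) ∧
      ∫ t in I, ε * w t / ((x - t) ^ 2 + ε ^ 2) ≤ C := by
  have hnhds : ∀ᶠ t in 𝓝 x, t ∈ I ∧ w x / 2 < w t ∧ w t < 2 * w x :=
    (show ∀ᶠ t in 𝓝 x, t ∈ I from mem_interior_iff_mem_nhds.mp hx).and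
      ((hc.eventually (lt_mem_nhds (by linarith))).and
        (hc.eventually (gt_mem_nhds (by linarith))))
  obtain ⟨δ, hδ, hball⟩ := Metric.eventually_nhds_iff.mp hnhds
  -- Lower bound: for `|x - t| ≤ ε` the kernel is at least `1 / (2ε)` and the density at least `w x
  -- / 2`, on an interval of length `2ε`. Upper bound: within `δ` the density is below `2 * w x` and
  -- the kernel has mass `π`; farther away the kernel is at most `1 / δ`, since `ε < δ`.
  refine ⟨w x / 2, by positivity, 2 * w x * Real.pi + (∫ t in I, w t) / δ, ?_⟩
  filter_upwards [Ioo_mem_nhdsGT hδ] with ε hε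
  obtain ⟨hε0, hεδ⟩ := hε
  have hnear : ∀ t, |x - t| < δ → t ∈ I ∧ w x / 2 < w t ∧ w t < 2 * w x := fun t ht =>
    hball (by rwa [dist_comm, Real.dist_eq])
  constructor
  · have hsub : Set.Icc (x - ε) (x + ε) ⊆ I := fun t ht =>
      (hnear t (abs_lt.mpr ⟨by linarith [ht.1, ht.2], by linarith [ht.1, ht.2]⟩)).1
    have h1 : ∫ t in Set.Icc (x - ε) (x + ε), w x / (4 * ε) = w x / 2 := by
      rw [setIntegral_const, Real.volume_real_Icc_of_le (by linarith), smul_eq_mul]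
      field_simp
      ring
    rw [← h1]
    have hint := integrableOn_poisson_mul hw x hε0
    refine (setIntegral_mono_on (by simp) (hint.mono_set hsub) measurableSet_Icc
      fun t ht => ?_).trans (setIntegral_mono_set hint ?_ hsub.eventuallyLE)
    · have hab : |x - t| ≤ ε := abs_le.mpr ⟨by linarith [ht.1, ht.2], by linarith [ht.1, ht.2]⟩
      have h2 := (hnear t (hab.trans_lt hεδ)).2.1
      have h3 : (x - t) ^ 2 ≤ ε ^ 2 := by
        rw [← sq_abs (x - t)]
        gcongr
      rw [div_le_div_iff₀ (by positivity) (by positivity)]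
      nlinarith [mul_pos hε0 hε0, mul_le_mul_of_nonneg_left h3 hpos.le,
        mul_le_mul_of_nonneg_left h2.le (mul_pos hε0 hε0).le]
    · filter_upwards [ae_restrict_mem hI] with t ht
      have := hn t ht
      simp only [Pi.zero_apply]
      positivity
  · have hp : Integrable fun t : ℝ => ε / ((t - x) ^ 2 + ε ^ 2) := integrable_poisson x hε0
    have h1 : ∫ t in I, ε * w t / ((x - t) ^ 2 + ε ^ 2) ≤
        ∫ t in I, (2 * w x * (ε / ((t - x) ^ 2 + ε ^ 2)) + w t / δ) := by
      refine setIntegral_mono_on (integrableOn_poisson_mul hw x hε0)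
        ((hp.integrableOn.const_mul _).add (hw.div_const _)) hI fun t ht => ?_
      have hwt := hn t ht
      by_cases hd : |x - t| < δ
      · have h2 := (hnear t hd).2.2
        have h3 : ε * w t / ((x - t) ^ 2 + ε ^ 2) ≤ 2 * w x * (ε / ((t - x) ^ 2 + ε ^ 2)) := by
          rw [mul_div_assoc', show (x - t) ^ 2 = (t - x) ^ 2 by ring]
          refine div_le_div_of_nonneg_right ?_ (by positivity)
          nlinarith
        have : 0 ≤ w t / δ := by positivity
        linarith
      · have h2 : δ ^ 2 ≤ (x - t) ^ 2 := by
          rw [← sq_abs (x - t)]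
          gcongr
          exact not_lt.mp hd
        have h3 : ε * w t / ((x - t) ^ 2 + ε ^ 2) ≤ w t / δ := by
          rw [div_le_div_iff₀ (by positivity) hδ]
          have : ε * δ ≤ (x - t) ^ 2 + ε ^ 2 := by nlinarith [sq_nonneg ε]
          nlinarith
        have : 0 ≤ 2 * w x * (ε / ((t - x) ^ 2 + ε ^ 2)) := by positivity
        linarith
    refine h1.trans ?_
    rw [integral_add (hp.integrableOn.const_mul _) (hw.div_const _), integral_const_mul,
      integral_div]
    gcongr
    exact (setIntegral_le_integral hp (Eventually.of_forall fun t => by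
      simp only [Pi.zero_apply]; positivity)).trans_eq (integral_poisson x hε0)

/-- The density `ρ` vanishes almost everywhere on the zero set of its secondary density. -/
theorem ae_secondary_pos {I : Set ℝ} (hI : I.OrdConnected) {ρ μ : ℝ → ℝ}
    (hρ : IsAdmissibleDensity I ρ) (hμ : IsSecondaryDensity I ρ μ) (hφ : ReducerExists I ρ) :
    ∀ᵐ x ∂(volume.restrict I), 0 < ρ x → 0 < μ x := by
  have hIm : MeasurableSet I := hI.measurableSet
  have := hμ.hasMoments.isFiniteMeasure
  rw [ae_restrict_iff' hIm]
  set N : Set ℝ := {x | x ∈ I ∧ 0 < ρ x ∧ μ x ≤ 0} with hN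
  suffices hvol : volume N = 0 by
    filter_upwards [measure_eq_zero_iff_ae_notMem.mp hvol] with x hx hxI hpos
    by_contra hcon
    exact hx ⟨hxI, hpos, not_lt.mp hcon⟩
  have hMN : densityMeasure I μ N = 0 := by
    rw [measure_eq_zero_iff_ae_notMem, densityMeasure,
      ae_withDensity_iff' hμ.hasMoments.aemeasurable.ennreal_ofReal]
    exact Eventually.of_forall fun x hx hxN => hx (ENNReal.ofReal_of_nonpos hxN.2.2)
  refine volume_eq_zero_of_poisson_pos hMN ?_
  have hfr : ∀ᵐ x, x ∉ frontier I := measure_eq_zero_iff_ae_notMem.mp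
    (hI.convex.addHaar_frontier volume)
  filter_upwards [hfr, (ae_restrict_iff' hIm).mp hφ] with x hxf hxφ hxN
  obtain ⟨hxI, hxρ, -⟩ := hxN
  have hxint : x ∈ interior I := by
    by_contra hcon
    exact hxf ⟨subset_closure hxI, hcon⟩
  obtain ⟨l, hl⟩ := hxφ hxI
  obtain ⟨c, hc, C, hbd⟩ := eventually_poisson_bounds hIm hρ.hasMoments.integrableOn hρ.nonneg
    hxint (hρ.continuousOn.continuousAt (isOpen_interior.mem_nhds hxint)) hxρ
  have hre : ∀ᶠ ε : ℝ in 𝓝[>] 0, |reducerApprox I ρ ε x| < |l| + 1 :=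
    hl.abs.eventually (gt_mem_nhds (lt_add_one _))
  -- `B` bounds `|S_ρ|²`, whose real part is half of `reducerApprox` and whose imaginary part is
  -- minus the Poisson integral of `ρ`.
  set B : ℝ := (|l| + 1) ^ 2 + C ^ 2 with hB
  have hBpos : 0 < B := by positivity
  -- Imaginary parts in the secondary equation give the Poisson integral of `μ` as `A / |S_ρ|² - ε`,
  -- with `A` that of `ρ`. The quotient is at least `c / B`, and `ε` takes away less than half of
  -- this.
  refine ⟨c / B / 2, by positivity, ?_⟩
  filter_upwards [hbd, hre, Ioo_mem_nhdsGT (show 0 < c / B / 2 by positivity)]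
    with ε hε1 hε2 hε3
  obtain ⟨hε0, hεlt⟩ := hε3
  have hz : ((x : ℂ) + ε * Complex.I).im ≠ 0 := by simpa using hε0.ne'
  have hst := congrArg Complex.im (hμ.stieltjes_eq _ (notMem_ofReal_image hz _))
  rw [im_stieltjes hμ.hasMoments.integrableOn x hε0, one_div] at hst
  simp only [Complex.sub_im, Complex.add_im, Complex.ofReal_im, Complex.mul_im, Complex.I_im,
    Complex.I_re, Complex.ofReal_re, Complex.inv_im, mul_one, mul_zero, add_zero, zero_add,
    sub_zero] at hst
  rw [Complex.normSq_apply, re_stieltjes hρ.hasMoments.integrableOn x hε0,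
    im_stieltjes hρ.hasMoments.integrableOn x hε0, neg_neg, neg_mul_neg] at hst
  rw [integral_densityMeasure hIm hμ.hasMoments.aemeasurable hμ.nonneg]
  simp only [div_mul_eq_mul_div]
  set A := ∫ t in I, ε * ρ t / ((x - t) ^ 2 + ε ^ 2)
  set r := reducerApprox I ρ ε x
  have hr : r ^ 2 ≤ (|l| + 1) ^ 2 := by
    rw [← sq_abs r]
    gcongr
  have hA : A ^ 2 ≤ C ^ 2 := by
    have : 0 ≤ A := hc.le.trans hε1.1
    gcongr
    exact hε1.2
  have hDpos : 0 < r / 2 * (r / 2) + A * A := by nlinarith [sq_nonneg r]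
  have hquot : c / B ≤ A / (r / 2 * (r / 2) + A * A) := by
    apply div_le_div₀ (hc.le.trans hε1.1) hε1.1 hDpos
    nlinarith [sq_nonneg r]
  linarith

/-! ### The reducer formula -/

theorem integral_densityMeasure_mul_inner {I : Set ℝ} {w : ℝ → ℝ} (f g : L2 I w) :
    inner ℝ g f = ∫ x, f x * g x ∂(densityMeasure I w) := by
  rw [L2.inner_def]
  simp

/-- Pairing with the class of `ρ / μ` in `L²(I, μ)` is integration against `ρ`. -/
theorem ae_mul_quotient {I : Set ℝ} (hI : I.OrdConnected) {ρ μ : ℝ → ℝ}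
    (hρ : IsAdmissibleDensity I ρ) (hμ : IsSecondaryDensity I ρ μ) (hφ : ReducerExists I ρ)
    {q : ℝ → ℝ} (hq : q =ᵐ[densityMeasure I μ] fun x => ρ x / μ x) (u : ℝ → ℝ) :
    (fun x => u x * q x * μ x) =ᵐ[volume.restrict I] fun x => u x * ρ x := by
  have hq' := (ae_withDensity_iff' hμ.hasMoments.aemeasurable.ennreal_ofReal).mp hq
  filter_upwards [hq', ae_secondary_pos hI hρ hμ hφ, ae_restrict_mem hI.measurableSet]
    with x hx hpos hxI
  -- Where `μ` vanishes, `hq` gives no information, but `ρ` vanishes there too.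
  rcases (hμ.nonneg x hxI).eq_or_lt with h0 | h0
  · have hρ0 : ρ x = 0 := by
      by_contra hne
      exact (hpos ((hρ.nonneg x hxI).lt_of_ne' hne)).ne h0
    rw [← h0, hρ0, mul_zero, mul_zero]
  · rw [hx (ENNReal.ofReal_pos.mpr h0).ne', mul_assoc, div_mul_cancel₀ _ h0.ne']

theorem integral_mul_reducer {I : Set ℝ} (hI : I.OrdConnected) {ρ μ : ℝ → ℝ}
    (hρ : IsAdmissibleDensity I ρ) (hμ : IsSecondaryDensity I ρ μ) (hφ : ReducerExists I ρ)
    (hred : IsReducible hρ.hasMoments hμ.hasMoments) (f : L2 I ρ) :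
    IntegrableOn (fun x => f x * reducer I ρ x * ρ x) I ∧
      IntegrableOn (fun x => secondaryOperator hρ.hasMoments hμ.hasMoments f x * ρ x) I ∧
      ∫ x in I, f x * reducer I ρ x * ρ x =
        ∫ x in I, secondaryOperator hρ.hasMoments hμ.hasMoments f x * ρ x := by
  have hIm := hI.measurableSet
  have mρ := hρ.hasMoments.aemeasurable
  have mμ := hμ.hasMoments.aemeasurable
  obtain ⟨g, hg⟩ := hred.quotient_mem_range
  set T := secondaryOperator hρ.hasMoments hμ.hasMoments with hT
  set φ : L2 I ρ := hred.memLp_reducer.toLp _ with hφL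
  have hφ_eq : (φ : ℝ → ℝ) =ᵐ[densityMeasure I ρ] reducer I ρ := hred.memLp_reducer.coeFn_toLp
  -- Membership of `ρ / μ` in the range makes integration against `ρ` a continuous functional on
  -- `L²(I, μ)`.
  have hR : ∀ u : L2 I μ, ∫ x in I, u x * ρ x = inner ℝ (T g) u := fun u => by
    rw [integral_densityMeasure_mul_inner, integral_densityMeasure hIm mμ hμ.nonneg]
    exact integral_congr_ae (ae_mul_quotient hI hρ hμ hφ hg u).symm
  have hL : ∀ f : L2 I ρ, ∫ x in I, f x * reducer I ρ x * ρ x = inner ℝ φ f := fun f => by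
    rw [integral_densityMeasure_mul_inner, ← integral_densityMeasure hIm mρ hρ.nonneg
      fun x => f x * reducer I ρ x]
    refine integral_congr_ae ?_
    filter_upwards [hφ_eq] with x hx
    rw [hx]
  refine ⟨?_, ?_, ?_⟩
  · exact (integrable_densityMeasure_iff hIm mρ hρ.nonneg _).mp
      ((Lp.memLp f).integrable_mul hred.memLp_reducer)
  · exact ((integrable_densityMeasure_iff hIm mμ hμ.nonneg _).mp
      ((Lp.memLp (T f)).integrable_mul (Lp.memLp (T g)))).congr
      (ae_mul_quotient hI hρ hμ hφ hg (T f))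
  · rw [hL, hR]
    have key : (fun f : L2 I ρ => inner ℝ φ f) = fun f => inner ℝ (T g) (T f) := by
      refine hρ.dense.equalizer (by fun_prop) (by fun_prop) (funext fun p => ?_)
      simp only [Function.comp_apply]
      rw [← hL, ← hR, hT, secondaryOperator_polyToL2 hIm hρ hμ]
      have h1 : ∫ x in I, polyToL2 hρ.hasMoments p x * reducer I ρ x * ρ x =
          ∫ x in I, p.eval x * reducer I ρ x * ρ x := by
        rw [← integral_densityMeasure hIm mρ hρ.nonneg
          fun x => polyToL2 hρ.hasMoments p x * reducer I ρ x,
          ← integral_densityMeasure hIm mρ hρ.nonneg fun x => p.eval x * reducer I ρ x]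
        refine integral_congr_ae ?_
        filter_upwards [(hρ.hasMoments.memLp_eval p).coeFn_toLp] with x hx
        simp only [polyToL2, LinearMap.coe_mk, AddHom.coe_mk, hx]
      -- The class is determined only `μ`-almost everywhere. Points with `μ = 0` do not matter,
      -- since `ρ` vanishes at almost all of them.
      have h2 : ∫ x in I, secondaryToL2 hρ.hasMoments hμ.hasMoments p x * ρ x =
          ∫ x in I, secondaryFun I ρ p x * ρ x := by
        have hae := (ae_withDensity_iff' mμ.ennreal_ofReal).mp
          (hρ.hasMoments.memLp_secondaryFun hμ.hasMoments p).coeFn_toLp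
        refine integral_congr_ae ?_
        filter_upwards [hae, ae_secondary_pos hI hρ hμ hφ, ae_restrict_mem hIm]
          with x hx hpos hxI
        rcases (hρ.nonneg x hxI).eq_or_lt with h0 | h0
        · rw [← h0, mul_zero, mul_zero]
        · simp only [secondaryToL2, LinearMap.coe_mk, AddHom.coe_mk,
            hx (ENNReal.ofReal_pos.mpr (hpos h0)).ne']
      rw [h1, h2]
      exact integral_eval_mul_reducer hIm hρ.nonneg hρ.hasMoments hred.memLp_reducer
        hred.tendsto_reducer p
    exact congrFun key f

end SecondaryMeasure

end

theorem mainTheorem7 (I : Set ℝ) (hI : I.OrdConnected) (ρ μ : ℝ → ℝ)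
    (hρ : SecondaryMeasure.IsAdmissibleDensity I ρ)
    (hμ : SecondaryMeasure.IsSecondaryDensity I ρ μ)
    (hφ : SecondaryMeasure.ReducerExists I ρ)
    (hred : SecondaryMeasure.IsReducible hρ.hasMoments hμ.hasMoments) :
    (∀ p : Polynomial ℝ,
      SecondaryMeasure.secondaryOperator hρ.hasMoments hμ.hasMoments
          (SecondaryMeasure.polyToL2 hρ.hasMoments p) =
        SecondaryMeasure.secondaryToL2 hρ.hasMoments hμ.hasMoments p) ∧
    ∀ f : SecondaryMeasure.L2 I ρ,
      IntegrableOn (fun x => f x * SecondaryMeasure.reducer I ρ x * ρ x) I ∧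
      IntegrableOn (fun x =>
        SecondaryMeasure.secondaryOperator hρ.hasMoments hμ.hasMoments f x * ρ x) I ∧
      ∫ x in I, f x * SecondaryMeasure.reducer I ρ x * ρ x =
        ∫ x in I, SecondaryMeasure.secondaryOperator hρ.hasMoments hμ.hasMoments f x * ρ x :=
  ⟨SecondaryMeasure.secondaryOperator_polyToL2 hI.measurableSet hρ hμ,
    SecondaryMeasure.integral_mul_reducer hI hρ hμ hφ hred⟩
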